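/- All digraphs are without loops and multiple edges; subdigraphs are full induced subdigraphs. For a vertex $x$ of a digraph $D$ let $D^n(x)$ be the set of vertices reachable from $x$ by a directed walk of length $n$, and let $\mathrm{desc}(x)=\bigcup_{n\ge 0}D^n(x)$. For a set $A$ of vertices of $D$ write $A\le D$ if $\mathrm{desc}(a)\subseteq A$ for all $a\in A$; call such an $A$ finitely generated if $A=\bigcup_{a\in X}\mathrm{desc}(a)$ for some finite $X\subseteq A$. Write $A\le^+D$ if $A\le D$ and, for every vertex $b$ of $D$, (i) if $\mathrm{desc}(b)\setminus A$ is finite then $b\in A$, and (ii) $\mathrm{desc}(b)\cap A$ is finitely generated. Let $\Gamma$ be a digraph with a root $\gamma$ such that: (P0) every vertex of $\Gamma$ lies in $\mathrm{desc}(\gamma)$, all vertices have the same finite out-valency $m>0$, and $\Gamma^s(\gamma)\cap\Gamma^t(\gamma)=\emptyset$ whenever $s\ne t$; (P1) $\mathrm{desc}(u)\cong\Gamma$ for all $u\in\Gamma$; (P2) $\mathrm{desc}(u)\le^+\Gamma$ for all $u\in\Gamma$; (P3) for every $n\ge 0$, $\mathrm{Aut}(\Gamma)$ is transitive on $\Gamma^n(\gamma)$.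 Let $\mathcal C_\Gamma$ be the class of finitely generated digraphs $A$ such that $\mathrm{desc}(a)\le^+A$ and $\mathrm{desc}(a)\cong\Gamma$ for all $a\in A$. Let $D_\Gamma$ be the countable digraph (unique up to isomorphism) with the following properties: (1) $\mathrm{desc}(a)\le^+D_\Gamma$ and $\mathrm{desc}(a)\cong\Gamma$ for all $a\in D_\Gamma$; (2) every finite set of vertices of $D_\Gamma$ is contained in a finitely generated $A\le^+D_\Gamma$ with $A\in\mathcal C_\Gamma$; (3) if $A\le^+D_\Gamma$ is finitely generated, $B\in\mathcal C_\Gamma$ and $f:A\to B$ is a digraph embedding with $f(A)\le^+B$, then there is a digraph embedding $g:B\to D_\Gamma$ with $g(f(a))=a$ for all $a\in A$ and $g(B)\le^+D_\Gamma$. Suppose that $a,b\in D_\Gamma$ are distinct vertices with $a\notin\mathrm{desc}(b)$ and $b\notin\mathrm{desc}(a)$. Then there exist an integer $r\ge 1$ and $g_1,\dots,g_r\in\mathrm{Aut}(D_\Gamma)$ such that, setting $b_0=a$, $b_1=b$ and $b_{i+1}=g_ib_i$ for $1\le i\le r$, we have $g_i b_{i-1}=b_{i-1}$ for $1\le i\le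 r$, and $\mathrm{desc}(b_r)\cap\mathrm{desc}(b_{r+1})=\emptyset$. -/

import Mathlib

universe u v

namespace DescDigraph

/-- The (full) induced subdigraph on a set of vertices. -/
def induce {V : Type u} (D : Digraph V) (A : Set V) : Digraph A where
  Adj x y := D.Adj x y

/-- Digraph isomorphisms. -/
abbrev Iso {V : Type u} {W : Type v} (D : Digraph V) (E : Digraph W) : Type (max u v) :=
  D.Adj ≃r E.Adj

/-- Digraph embeddings: injective maps that preserve and reflect edges, i.e. isomorphisms onto
an induced subdigraph. -/
abbrev Emb {V : Type u} {W : Type v} (D : Digraph V) (E : Digraph W) : Type (max u v) :=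
  D.Adj ↪r E.Adj

/-- The automorphisms of a digraph. -/
abbrev Aut {V : Type u} (D : Digraph V) : Type u := Iso D D

/-- `level D n x` is the set of vertices reachable from `x` by a directed walk of length `n`.
In an asymmetric digraph (no edges in both directions between two vertices, no loops) a walk never
backtracks, so these are the vertices reachable by an `n`-arc; all digraphs considered below are
asymmetric, since condition `P0` rules out directed cycles. -/
def level {V : Type u} (D : Digraph V) : ℕ → V → Set V
  | 0, x => {x}
  | n + 1, x => {z | ∃ y ∈ level D n x, D.Adj y z}

/-- The descendant set of a vertex. -/
def desc {V : Type u} (D : Digraph V) (x : V) : Set V := ⋃ n : ℕ, level D n x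

/-- `A ≤ D`: the set `A` contains all descendants of its elements. -/
def Closed {V : Type u} (D : Digraph V) (A : Set V) : Prop := ∀ a ∈ A, desc D a ⊆ A

/-- `A` is finitely generated: it is the union of the descendant sets of a finite subset. -/
def FinGen {V : Type u} (D : Digraph V) (A : Set V) : Prop :=
  ∃ X : Set V, X.Finite ∧ X ⊆ A ∧ A = ⋃ a ∈ X, desc D a

/-- `A ≤⁺ D`. -/
structure Strong {V : Type u} (D : Digraph V) (A : Set V) : Prop where
  closed : Closed D A
  mem_of_finite : ∀ b : V, (desc D b \ A).Finite → b ∈ A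
  finGen_inter : ∀ b : V, FinGen D (desc D b ∩ A)

/-- Condition P0 for a digraph `Γ` with root `γ`: every vertex is a descendant of `γ`, all vertices
have the same finite non-zero out-valency, and the levels with respect to `γ` are disjoint. -/
structure P0 {V : Type u} (Γ : Digraph V) (γ : V) : Prop where
  rooted : desc Γ γ = Set.univ
  outValency : ∃ m : ℕ, 0 < m ∧ ∀ x : V, {y | Γ.Adj x y}.encard = m
  disjoint : ∀ s t : ℕ, s ≠ t → Disjoint (level Γ s γ) (level Γ t γ)

/-- Condition P1: all descendant sets are isomorphic to `Γ`. -/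
def P1 {V : Type u} (Γ : Digraph V) : Prop :=
  ∀ x : V, Nonempty (Iso (induce Γ (desc Γ x)) Γ)

/-- Condition P2: `desc a ≤⁺ Γ` for every vertex `a`. -/
def P2 {V : Type u} (Γ : Digraph V) : Prop := ∀ a : V, Strong Γ (desc Γ a)

/-- Condition P3: the automorphism group is transitive on each level. -/
def P3 {V : Type u} (Γ : Digraph V) (γ : V) : Prop :=
  ∀ n : ℕ, ∀ x ∈ level Γ n γ, ∀ y ∈ level Γ n γ, ∃ φ : Aut Γ, φ x = y

/-- The class `C̄_Γ` of digraphs `A` such that `desc a ≤⁺ A` and `desc a ≅ Γ` for every `a`. -/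
def InCBar {V : Type u} {W : Type v} (Γ : Digraph V) (A : Digraph W) : Prop :=
  ∀ a : W, Strong A (desc A a) ∧ Nonempty (Iso (induce A (desc A a)) Γ)

/-- The class `C_Γ` of finitely generated members of `C̄_Γ`. -/
def InC {V : Type u} {W : Type v} (Γ : Digraph V) (A : Digraph W) : Prop :=
  InCBar Γ A ∧ FinGen A Set.univ

/-- `D` is the digraph `D_Γ`: the countable digraph determined, up to isomorphism, by these
conditions (the generic or Fraïssé limit of `C_Γ` with respect to `≤⁺`-embeddings). Members of
`C_Γ` are countable, so it does not matter from which universe `B` is taken in `extension`. -/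
structure IsGeneric {V : Type u} {W : Type v} (Γ : Digraph V) (D : Digraph W) : Prop where
  countable : Countable W
  inCBar : ∀ a : W, Strong D (desc D a) ∧ Nonempty (Iso (induce D (desc D a)) Γ)
  exists_finGen : ∀ X : Set W, X.Finite →
    ∃ A : Set W, Strong D A ∧ FinGen D A ∧ X ⊆ A ∧ InC Γ (induce D A)
  extension : ∀ A : Set W, Strong D A → FinGen D A →
    ∀ (U : Type v) (B : Digraph U), InC Γ B →
    ∀ f : Emb (induce D A) B, Strong B (Set.range f) →
    ∃ g : Emb B D, (∀ a : A, g (f a) = a) ∧ Strong D (Set.range g)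

end DescDigraph


/-!
Amalgamate two copies of a finitely generated `A ≤⁺ D` containing `p` and `q` freely over `desc p`,
glued along an automorphism of `desc p`. Homogeneity of the generic digraph turns the amalgam into
an automorphism `g` fixing `p` and inducing the chosen automorphism on `desc p`, for which
`desc q ∩ desc (g q) ⊆ desc p`.

In `Γ` the in-degree is constant on levels by transitivity, non-decreasing in the level by
self-similarity, and takes values at most the out-valency `m` on infinitely many levels, since
otherwise counting edges would make the level sizes decrease forever. Hence it is eventually
constant, so the in-neighbours of a deep vertex of `desc x` already lie in `desc x`. Consequently,
for a fixed `N`, the descendant sets of `p` and `q` are disjoint as soon as `desc q` misses level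
`N` of `desc p`. If it does not, choose `g` to move a vertex of that level outside `desc q` to one
inside: replacing `(p, q)` by `(q, g q)` strictly decreases the number of level-`N` vertices of the
first descendant set lying in the second.
-/

namespace DescDigraph

open Filter

section Basic

variable {V : Type*} {D : Digraph V}

theorem mem_desc {x y : V} : y ∈ desc D x ↔ ∃ n, y ∈ level D n x :=
  Set.mem_iUnion

theorem level_subset_desc (n : ℕ) (x : V) : level D n x ⊆ desc D x :=
  Set.subset_iUnion (fun n => level D n x) n

theorem self_mem_desc (x : V) : x ∈ desc D x :=
  level_subset_desc 0 x rfl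

theorem mem_level_add {x z : V} {m n : ℕ} :
    z ∈ level D (m + n) x ↔ ∃ y ∈ level D m x, z ∈ level D n y := by
  induction n generalizing z with
  | zero => exact ⟨fun h => ⟨z, h, rfl⟩, fun ⟨_, hy, hz⟩ => hz ▸ hy⟩
  | succ n ih =>
    constructor
    · rintro ⟨t, ht, htz⟩
      obtain ⟨y, hy, hyt⟩ := ih.1 ht
      exact ⟨y, hy, t, hyt, htz⟩
    · rintro ⟨y, hy, t, hyt, htz⟩
      exact ⟨t, ih.2 ⟨y, hy, hyt⟩, htz⟩

theorem level_finite (h : ∀ x, {y | D.Adj x y}.Finite) (x : V) (n : ℕ) :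
    (level D n x).Finite := by
  induction n with
  | zero => exact Set.finite_singleton x
  | succ n ih => exact (ih.biUnion fun y _ => h y).subset fun z ⟨y, hy, hyz⟩ =>
      Set.mem_biUnion hy hyz

theorem level_nonempty (h : ∀ x, ∃ y, D.Adj x y) (x : V) (n : ℕ) : (level D n x).Nonempty := by
  induction n with
  | zero => exact ⟨x, rfl⟩
  | succ n ih =>
    obtain ⟨y, hy⟩ := ih
    obtain ⟨z, hyz⟩ := h y
    exact ⟨z, y, hy, hyz⟩

theorem closed_univ : Closed D Set.univ := fun _ _ => Set.subset_univ _

theorem closed_desc (x : V) : Closed D (desc D x) := by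
  intro y hy z hz
  obtain ⟨m, hm⟩ := mem_desc.1 hy
  obtain ⟨n, hn⟩ := mem_desc.1 hz
  exact level_subset_desc (m + n) x (mem_level_add.2 ⟨y, hm, hn⟩)

theorem Closed.mem_of_adj {A : Set V} (hA : Closed D A) {a b : V} (ha : a ∈ A)
    (hab : D.Adj a b) : b ∈ A :=
  hA a ha (level_subset_desc 1 a ⟨a, rfl, hab⟩)

theorem closed_of_adj {A : Set V} (h : ∀ a ∈ A, ∀ b, D.Adj a b → b ∈ A) : Closed D A := by
  have level_subset (a : V) (ha : a ∈ A) (n : ℕ) : level D n a ⊆ A := by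
    induction n with
    | zero => exact Set.singleton_subset_iff.2 ha
    | succ n ih => exact fun b ⟨c, hc, hcb⟩ => h c (ih hc) b hcb
  exact fun a ha => Set.iUnion_subset (level_subset a ha)

theorem finGen_biUnion_desc {X : Set V} (hX : X.Finite) : FinGen D (⋃ a ∈ X, desc D a) :=
  ⟨X, hX, fun a ha => Set.mem_biUnion ha (self_mem_desc a), rfl⟩

theorem finGen_desc (x : V) : FinGen D (desc D x) := by
  simpa using finGen_biUnion_desc (D := D) (Set.finite_singleton x)

theorem FinGen.biUnion {ι : Type*} {X : Set ι} (hX : X.Finite) {F : ι → Set V}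
    (hF : ∀ i ∈ X, FinGen D (F i)) : FinGen D (⋃ i ∈ X, F i) := by
  choose! Y hY _ hF using hF
  have hunion : ⋃ i ∈ X, F i = ⋃ a ∈ ⋃ i ∈ X, Y i, desc D a := by
    rw [Set.iUnion₂_congr hF]
    simp only [Set.biUnion_iUnion]
  exact hunion ▸ finGen_biUnion_desc (hX.biUnion hY)

theorem FinGen.union {A B : Set V} (hA : FinGen D A) (hB : FinGen D B) : FinGen D (A ∪ B) := by
  obtain ⟨X, hX, -, rfl⟩ := hA
  obtain ⟨Y, hY, -, rfl⟩ := hB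
  rw [← Set.biUnion_union]
  exact finGen_biUnion_desc (hX.union hY)

end Basic

section Embeddings

variable {V W : Type*} {T : Digraph V} {B : Digraph W}

/-- The inclusion of an induced subdigraph. -/
def inclusion (B : Digraph W) (A : Set W) : Emb (induce B A) B :=
  Subrel.relEmbedding B.Adj (· ∈ A)

@[simp]
theorem range_inclusion (B : Digraph W) (A : Set W) : Set.range (inclusion B A) = A :=
  Subtype.range_val

/-- An embedding with values in `A`, as an embedding into the subdigraph induced on `A`. -/
def codRestrict (f : Emb T B) (A : Set W) (h : ∀ x, f x ∈ A) : Emb T (induce B A) :=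
  RelEmbedding.codRestrict A f h

theorem level_map (f : Emb T B) (hf : Closed B (Set.range f)) (n : ℕ) (x : V) :
    level B n (f x) = f '' level T n x := by
  induction n with
  | zero => exact Set.image_singleton.symm
  | succ n ih =>
    apply Set.Subset.antisymm
    · rintro z ⟨y, hy, hyz⟩
      rw [ih] at hy
      obtain ⟨y, hy, rfl⟩ := hy
      obtain ⟨z, rfl⟩ := hf.mem_of_adj ⟨y, rfl⟩ hyz
      exact ⟨z, ⟨y, hy, f.map_rel_iff.1 hyz⟩, rfl⟩
    · rintro _ ⟨z, ⟨y, hy, hyz⟩, rfl⟩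
      exact ⟨f y, ih ▸ Set.mem_image_of_mem f hy, f.map_rel_iff.2 hyz⟩

theorem desc_map (f : Emb T B) (hf : Closed B (Set.range f)) (x : V) :
    desc B (f x) = f '' desc T x := by
  simp only [desc, level_map f hf, Set.image_iUnion]

theorem iso_mem_level_iff (e : Iso T B) {n : ℕ} {x y : V} :
    e y ∈ level B n (e x) ↔ y ∈ level T n x := by
  have he : Closed B (Set.range e.toRelEmbedding) := e.surjective.range_eq ▸ closed_univ
  exact (level_map e.toRelEmbedding he n x) ▸ e.injective.mem_set_image

theorem iso_mem_desc_iff (e : Iso T B) {x y : V} : e y ∈ desc B (e x) ↔ y ∈ desc T x := by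
  simp only [mem_desc, iso_mem_level_iff]

theorem finGen_image_iff (f : Emb T B) (hf : Closed B (Set.range f)) {S : Set V} :
    FinGen B (f '' S) ↔ FinGen T S := by
  have biUnion_desc_image (X : Set V) :
      ⋃ b ∈ f '' X, desc B b = f '' ⋃ a ∈ X, desc T a := by
    simp only [Set.biUnion_image, desc_map f hf, Set.image_iUnion]
  constructor
  · rintro ⟨X, hX, hXS, hS⟩
    obtain ⟨Y, -, rfl⟩ := Set.subset_image_iff.1 hXS
    rw [biUnion_desc_image] at hS
    rw [f.injective.image_injective hS]
    exact finGen_biUnion_desc (hX.of_finite_image f.injective.injOn)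
  · rintro ⟨X, hX, -, rfl⟩
    rw [← biUnion_desc_image]
    exact finGen_biUnion_desc (hX.image f)

theorem finGen_induce_univ_iff {A : Set W} (hA : Closed B A) :
    FinGen (induce B A) Set.univ ↔ FinGen B A := by
  rw [← finGen_image_iff (inclusion B A) (by rwa [range_inclusion]), Set.image_univ,
    range_inclusion]

theorem Strong.preimage {A : Set W} (hA : Strong B A) (f : Emb T B)
    (hf : Closed B (Set.range f)) : Strong T (f ⁻¹' A) where
  closed x hx := by
    rw [← Set.image_subset_iff, ← desc_map f hf]
    exact hA.closed (f x) hx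
  mem_of_finite x hx := by
    apply hA.mem_of_finite
    rw [desc_map f hf, ← Set.image_sdiff_preimage]
    exact hx.image f
  finGen_inter x := by
    rw [← finGen_image_iff f hf, Set.image_inter_preimage, ← desc_map f hf]
    exact hA.finGen_inter (f x)

theorem Strong.image {S : Set V} (hS : Strong T S) (f : Emb T B) (hf : Strong B (Set.range f)) :
    Strong B (f '' S) where
  closed := by
    rintro _ ⟨x, hx, rfl⟩
    rw [desc_map f hf.closed]
    exact Set.image_mono (hS.closed x hx)
  mem_of_finite b hb := by
    obtain ⟨x, rfl⟩ := hf.mem_of_finite b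
      (hb.subset (Set.sdiff_subset_sdiff_right (Set.image_subset_range f S)))
    rw [desc_map f hf.closed, ← Set.image_sdiff f.injective] at hb
    exact ⟨x, hS.mem_of_finite x (hb.of_finite_image f.injective.injOn), rfl⟩
  finGen_inter b := by
    obtain ⟨X, hX, hXb, hbX⟩ := hf.finGen_inter b
    have hcover : desc B b ∩ f '' S = ⋃ a ∈ X, desc B a ∩ f '' S := by
      rw [← Set.iUnion₂_inter, ← hbX, Set.inter_assoc,
        Set.inter_eq_self_of_subset_right (Set.image_subset_range f S)]
    rw [hcover]
    refine FinGen.biUnion hX fun a ha => ?_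
    obtain ⟨x, rfl⟩ := (hXb ha).2
    rw [desc_map f hf.closed, ← Set.image_inter f.injective, finGen_image_iff f hf.closed]
    exact hS.finGen_inter x

theorem strong_range_codRestrict (f : Emb T B) {A : Set W} (hA : Closed B A) (h : ∀ x, f x ∈ A)
    (hf : Strong B (Set.range f)) : Strong (induce B A) (Set.range (codRestrict f A h)) := by
  have hrange : Set.range (codRestrict f A h) = inclusion B A ⁻¹' Set.range f :=
    Set.ext fun _ => exists_congr fun _ => Subtype.ext_iff
  exact hrange ▸ hf.preimage (inclusion B A) (by rwa [range_inclusion])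

theorem nonempty_iso_desc_map (f : Emb T B) (hf : Closed B (Set.range f)) (x : V) :
    Nonempty (Iso (induce B (desc B (f x))) (induce T (desc T x))) := by
  rw [desc_map f hf]
  exact ⟨RelIso.symm ⟨Equiv.Set.image f _ f.injective, f.map_rel_iff⟩⟩

end Embeddings

section Classes

variable {V W U : Type*} {Γ : Digraph U} {T : Digraph V} {B : Digraph W}

theorem InCBar.comap (hB : InCBar Γ B) (f : Emb T B) (hf : Closed B (Set.range f)) :
    InCBar Γ T := by
  intro x
  obtain ⟨hstrong, ⟨e⟩⟩ := hB (f x)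
  obtain ⟨e'⟩ := nonempty_iso_desc_map f hf x
  refine ⟨?_, ⟨e'.symm.trans e⟩⟩
  rw [← Set.preimage_image_eq (desc T x) f.injective, ← desc_map f hf]
  exact hstrong.preimage f hf

theorem InCBar.inC_induce (hB : InCBar Γ B) {A : Set W} (hA : Closed B A) (hfg : FinGen B A) :
    InC Γ (induce B A) :=
  ⟨hB.comap (inclusion B A) (by rwa [range_inclusion]), (finGen_induce_univ_iff hA).2 hfg⟩

theorem InCBar.strong_desc_map (hT : InCBar Γ T) (f : Emb T B) (hf : Strong B (Set.range f))
    (x : V) : Strong B (desc B (f x)) :=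
  desc_map f hf.closed x ▸ (hT x).1.image f hf

theorem InCBar.nonempty_iso_desc_map (hT : InCBar Γ T) (f : Emb T B)
    (hf : Closed B (Set.range f)) (x : V) : Nonempty (Iso (induce B (desc B (f x))) Γ) :=
  (DescDigraph.nonempty_iso_desc_map f hf x).map2 RelIso.trans (hT x).2

end Classes

section Amalgam

theorem exists_amalgam_of_injective {K : Type*} {V₁ : Type u} {V₂ : Type v} {i₁ : K → V₁}
    {i₂ : K → V₂} (h₁ : i₁.Injective) (h₂ : i₂.Injective) :
    ∃ (U : Type max u v) (j₁ : V₁ → U) (j₂ : V₂ → U), j₁.Injective ∧ j₂.Injective ∧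
      (∀ z, j₁ (i₁ z) = j₂ (i₂ z)) ∧ (∀ x y, j₁ x = j₂ y → ∃ z, i₁ z = x ∧ i₂ z = y) ∧
      Set.range j₁ ∪ Set.range j₂ = Set.univ := by
  classical
  let j₁ : V₁ → V₁ ⊕ ↥(Set.range i₂)ᶜ := Sum.inl
  let j₂ : V₂ → V₁ ⊕ ↥(Set.range i₂)ᶜ :=
    Sum.map (i₁ ∘ (Equiv.ofInjective i₂ h₂).symm) id ∘ (Equiv.Set.sumCompl (Set.range i₂)).symm
  have comm (z : K) : j₁ (i₁ z) = j₂ (i₂ z) := by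
    simp [j₁, j₂, Equiv.Set.sumCompl_symm_apply_of_mem (Set.mem_range_self (f := i₂) z)]
  have apply_of_notMem (y : V₂) (hy : y ∉ Set.range i₂) : j₂ y = Sum.inr ⟨y, hy⟩ := by
    simp [j₂, Equiv.Set.sumCompl_symm_apply_of_notMem hy]
  refine ⟨_, j₁, j₂, Sum.inl_injective, ?_, comm, fun x y hxy => ?_,
    Set.eq_univ_of_forall ?_⟩
  · exact ((h₁.comp (Equiv.injective _)).sumMap Function.injective_id).comp (Equiv.injective _)
  · by_cases hy : y ∈ Set.range i₂
    · obtain ⟨z, rfl⟩ := hy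
      exact ⟨z, Sum.inl_injective ((comm z).trans hxy.symm), rfl⟩
    · rw [apply_of_notMem y hy] at hxy
      exact absurd hxy Sum.inl_ne_inr
  · rintro (x | ⟨y, hy⟩)
    · exact Or.inl ⟨x, rfl⟩
    · exact Or.inr ⟨y, apply_of_notMem y hy⟩

variable {C V₁ V₂ U : Type*} {K : Digraph C} {T₁ : Digraph V₁} {T₂ : Digraph V₂} {B : Digraph U}

/-- `B` is the free amalgam of `T₁` and `T₂` over `K`: the union of copies of `T₁` and `T₂` that
meet exactly in `K`, with no edges beyond those of `T₁` and `T₂`. -/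
structure IsFreeAmalgam (i₁ : Emb K T₁) (i₂ : Emb K T₂) (f₁ : Emb T₁ B) (f₂ : Emb T₂ B) :
    Prop where
  comm : ∀ z, f₁ (i₁ z) = f₂ (i₂ z)
  exists_of_eq : ∀ x y, f₁ x = f₂ y → ∃ z, i₁ z = x ∧ i₂ z = y
  range_union_range : Set.range f₁ ∪ Set.range f₂ = Set.univ
  adj : ∀ b b', B.Adj b b' → Relation.Map T₁.Adj f₁ f₁ b b' ∨ Relation.Map T₂.Adj f₂ f₂ b b'

theorem map_adj_sup_map_adj_iff {i₁ : Emb K T₁} {i₂ : Emb K T₂} {j₁ : V₁ → U} {j₂ : V₂ → U}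
    (h₁ : j₁.Injective) (hj : ∀ x y, j₁ x = j₂ y → ∃ z, i₁ z = x ∧ i₂ z = y) {x y : V₁} :
    (Relation.Map T₁.Adj j₁ j₁ ⊔ Relation.Map T₂.Adj j₂ j₂) (j₁ x) (j₁ y) ↔ T₁.Adj x y := by
  constructor
  · rintro (⟨x', y', hxy, hx, hy⟩ | ⟨x', y', hxy, hx, hy⟩)
    · rwa [← h₁ hx, ← h₁ hy]
    · obtain ⟨z, rfl, rfl⟩ := hj x x' hx.symm
      obtain ⟨w, rfl, rfl⟩ := hj y y' hy.symm
      exact i₁.map_rel_iff.2 (i₂.map_rel_iff.1 hxy)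
  · exact fun hxy => Or.inl ⟨x, y, hxy, rfl, rfl⟩

theorem exists_isFreeAmalgam {C : Type*} {V₁ : Type u} {V₂ : Type v} {K : Digraph C}
    {T₁ : Digraph V₁} {T₂ : Digraph V₂} (i₁ : Emb K T₁) (i₂ : Emb K T₂) :
    ∃ (U : Type max u v) (B : Digraph U) (f₁ : Emb T₁ B) (f₂ : Emb T₂ B),
      IsFreeAmalgam i₁ i₂ f₁ f₂ := by
  obtain ⟨U, j₁, j₂, h₁, h₂, comm, exists_of_eq, hcover⟩ :=
    exists_amalgam_of_injective i₁.injective i₂.injective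
  let B : Digraph U := ⟨Relation.Map T₁.Adj j₁ j₁ ⊔ Relation.Map T₂.Adj j₂ j₂⟩
  have exists_of_eq' (y : V₂) (x : V₁) (h : j₂ y = j₁ x) : ∃ z, i₂ z = y ∧ i₁ z = x :=
    (exists_of_eq x y h.symm).imp fun _ => And.symm
  let f₁ : Emb T₁ B := ⟨⟨j₁, h₁⟩, map_adj_sup_map_adj_iff h₁ exists_of_eq⟩
  let f₂ : Emb T₂ B := ⟨⟨j₂, h₂⟩, by
    intro x y
    have h := map_adj_sup_map_adj_iff (T₁ := T₂) (T₂ := T₁) (x := x) (y := y) h₂ exists_of_eq'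
    rwa [sup_comm] at h⟩
  exact ⟨U, B, f₁, f₂, comm, exists_of_eq, hcover, fun _ _ h => h⟩

namespace IsFreeAmalgam

variable {i₁ : Emb K T₁} {i₂ : Emb K T₂} {f₁ : Emb T₁ B} {f₂ : Emb T₂ B}

theorem symm (h : IsFreeAmalgam i₁ i₂ f₁ f₂) : IsFreeAmalgam i₂ i₁ f₂ f₁ where
  comm z := (h.comm z).symm
  exists_of_eq x y hxy := (h.exists_of_eq y x hxy.symm).imp fun _ => And.symm
  range_union_range := Set.union_comm _ _ ▸ h.range_union_range
  adj b b' hb := (h.adj b b' hb).symm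

theorem preimage_range (h : IsFreeAmalgam i₁ i₂ f₁ f₂) :
    f₂ ⁻¹' Set.range f₁ = Set.range i₂ := by
  apply Set.Subset.antisymm
  · rintro y ⟨x, hx⟩
    obtain ⟨z, -, rfl⟩ := h.exists_of_eq x y hx
    exact ⟨z, rfl⟩
  · rintro _ ⟨z, rfl⟩
    exact ⟨i₁ z, h.comm z⟩

theorem closed_range_left (h : IsFreeAmalgam i₁ i₂ f₁ f₂) (h₂ : Closed T₂ (Set.range i₂)) :
    Closed B (Set.range f₁) := by
  refine closed_of_adj fun b hb b' hbb' => ?_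
  rcases h.adj b b' hbb' with ⟨-, y, -, -, rfl⟩ | ⟨x, y, hxy, rfl, rfl⟩
  · exact ⟨y, rfl⟩
  · rw [← Set.mem_preimage, h.preimage_range] at hb ⊢
    exact h₂.mem_of_adj hb hxy

theorem strong_range_left (h : IsFreeAmalgam i₁ i₂ f₁ f₂) (h₁ : Closed T₁ (Set.range i₁))
    (h₂ : Strong T₂ (Set.range i₂)) : Strong B (Set.range f₁) := by
  have hf₁ := h.closed_range_left h₂.closed
  have hf₂ := h.symm.closed_range_left h₁
  have mem_or (b : U) : b ∈ Set.range f₁ ∪ Set.range f₂ :=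
    h.range_union_range ▸ Set.mem_univ b
  refine ⟨hf₁, fun b hb => ?_, fun b => ?_⟩
  · obtain hb₁ | ⟨y, rfl⟩ := mem_or b
    · exact hb₁
    · rw [desc_map f₂ hf₂, ← Set.image_sdiff_preimage, h.preimage_range] at hb
      rw [← Set.mem_preimage, h.preimage_range]
      exact h₂.mem_of_finite y (hb.of_finite_image f₂.injective.injOn)
  · obtain hb₁ | ⟨y, rfl⟩ := mem_or b
    · rw [Set.inter_eq_self_of_subset_left (hf₁ b hb₁)]
      exact finGen_desc b
    · rw [desc_map f₂ hf₂, ← Set.image_inter_preimage, h.preimage_range,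
        finGen_image_iff f₂ hf₂]
      exact h₂.finGen_inter y

theorem inC {X : Type*} {Γ : Digraph X} (h : IsFreeAmalgam i₁ i₂ f₁ f₂)
    (h₁ : Strong T₁ (Set.range i₁)) (h₂ : Strong T₂ (Set.range i₂))
    (hT₁ : InC Γ T₁) (hT₂ : InC Γ T₂) : InC Γ B := by
  have hf₁ := h.strong_range_left h₁.closed h₂
  have hf₂ := h.symm.strong_range_left h₂.closed h₁
  constructor
  · intro b
    obtain ⟨x, rfl⟩ | ⟨x, rfl⟩ : b ∈ Set.range f₁ ∪ Set.range f₂ :=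
      h.range_union_range ▸ Set.mem_univ b
    · exact ⟨hT₁.1.strong_desc_map f₁ hf₁ x, hT₁.1.nonempty_iso_desc_map f₁ hf₁.closed x⟩
    · exact ⟨hT₂.1.strong_desc_map f₂ hf₂ x, hT₂.1.nonempty_iso_desc_map f₂ hf₂.closed x⟩
  · rw [← h.range_union_range, ← Set.image_univ, ← Set.image_univ]
    exact ((finGen_image_iff f₁ hf₁.closed).2 hT₁.2).union
      ((finGen_image_iff f₂ hf₂.closed).2 hT₂.2)

end IsFreeAmalgam

end Amalgam


section Homogeneity

section Graphs

variable {W W' : Type*} {D : Digraph W} {E : Digraph W'} {R : Set (W × W')}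

/-- `R` is the graph of an isomorphism between the subdigraphs of `D` and `E` induced on its two
projections. Working with graphs makes inverses and directed unions of partial isomorphisms
available without transport along equalities of their domains. -/
structure IsIsoGraph (D : Digraph W) (E : Digraph W') (R : Set (W × W')) : Prop where
  eq_iff : ∀ s ∈ R, ∀ t ∈ R, s.1 = t.1 ↔ s.2 = t.2
  adj_iff : ∀ s ∈ R, ∀ t ∈ R, D.Adj s.1 t.1 ↔ E.Adj s.2 t.2

theorem IsIsoGraph.swap (h : IsIsoGraph D E R) : IsIsoGraph E D (Prod.swap ⁻¹' R) where
  eq_iff s hs t ht := (h.eq_iff s.swap hs t.swap ht).symm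
  adj_iff s hs t ht := (h.adj_iff s.swap hs t.swap ht).symm

theorem IsIsoGraph.sUnion {J : Set (Set (W × W'))} (hJ : DirectedOn (· ⊆ ·) J)
    (h : ∀ S ∈ J, IsIsoGraph D E S) : IsIsoGraph D E (⋃₀ J) where
  eq_iff := by
    rintro s ⟨S, hS, hs⟩ t ⟨T, hT, ht⟩
    obtain ⟨U, hU, hSU, hTU⟩ := hJ S hS T hT
    exact (h U hU).eq_iff s (hSU hs) t (hTU ht)
  adj_iff := by
    rintro s ⟨S, hS, hs⟩ t ⟨T, hT, ht⟩
    obtain ⟨U, hU, hSU, hTU⟩ := hJ S hS T hT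
    exact (h U hU).adj_iff s (hSU hs) t (hTU ht)

theorem IsIsoGraph.exists_emb (h : IsIsoGraph D E R) :
    ∃ f : Emb (induce D (Prod.fst '' R)) E,
      Set.range f = Prod.snd '' R ∧ ∀ p (hp : p ∈ R), f ⟨p.1, p, hp, rfl⟩ = p.2 := by
  choose s hs hfst using fun x : Prod.fst '' R => x.2
  let f : Emb (induce D (Prod.fst '' R)) E := by
    refine ⟨⟨fun x => (s x).2, fun x y hxy => Subtype.ext ?_⟩, fun {x y} => ?_⟩
    · rw [← hfst x, ← hfst y]
      exact (h.eq_iff _ (hs x) _ (hs y)).2 hxy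
    · refine (h.adj_iff _ (hs x) _ (hs y)).symm.trans ?_
      rw [hfst x, hfst y]
      rfl
  have hf (p : W × W') (hp : p ∈ R) : f ⟨p.1, p, hp, rfl⟩ = p.2 :=
    (h.eq_iff _ (hs _) p hp).1 (hfst _)
  refine ⟨f, Set.Subset.antisymm ?_ ?_, hf⟩
  · rintro _ ⟨x, rfl⟩
    exact ⟨s x, hs x, rfl⟩
  · rintro _ ⟨p, hp, rfl⟩
    exact ⟨_, hf p hp⟩

theorem IsIsoGraph.exists_iso (h : IsIsoGraph D E R) (hdom : ∀ d, ∃ e, (d, e) ∈ R)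
    (hran : ∀ e, ∃ d, (d, e) ∈ R) : ∃ φ : Iso D E, ∀ p ∈ R, φ p.1 = p.2 := by
  choose φ hφ using hdom
  choose ψ hψ using hran
  refine ⟨⟨⟨φ, ψ, fun x => ?_, fun y => ?_⟩, fun {x y} => ?_⟩, fun p hp => ?_⟩
  · exact (h.eq_iff _ (hψ (φ x)) _ (hφ x)).2 rfl
  · exact (h.eq_iff _ (hφ (ψ y)) _ (hψ y)).1 rfl
  · exact (h.adj_iff _ (hφ x) _ (hφ y)).symm
  · exact (h.eq_iff _ (hφ p.1) p hp).1 rfl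

/-- `R` is the graph of an isomorphism between finitely generated `≤⁺`-subdigraphs of `D` and `E`:
the conditions of the back-and-forth construction. -/
structure IsPartialIso (D : Digraph W) (E : Digraph W') (R : Set (W × W')) : Prop
    extends IsIsoGraph D E R where
  strong_dom : Strong D (Prod.fst '' R)
  finGen_dom : FinGen D (Prod.fst '' R)
  strong_ran : Strong E (Prod.snd '' R)
  finGen_ran : FinGen E (Prod.snd '' R)

theorem IsPartialIso.swap (h : IsPartialIso D E R) : IsPartialIso E D (Prod.swap ⁻¹' R) := by
  have hfst : Prod.fst '' (Prod.swap ⁻¹' R) = Prod.snd '' R := by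
    rw [← Set.image_swap_eq_preimage_swap, Set.image_image]
    rfl
  have hsnd : Prod.snd '' (Prod.swap ⁻¹' R) = Prod.fst '' R := by
    rw [← Set.image_swap_eq_preimage_swap, Set.image_image]
    rfl
  refine ⟨h.toIsIsoGraph.swap, ?_, ?_, ?_, ?_⟩
  · exact hfst ▸ h.strong_ran
  · exact hfst ▸ h.finGen_ran
  · exact hsnd ▸ h.strong_dom
  · exact hsnd ▸ h.finGen_dom

theorem isPartialIso_graph {A : Set W} (hA : Strong D A) (hfg : FinGen D A)
    (f : Emb (induce D A) E) (hf : Strong E (Set.range f)) :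
    IsPartialIso D E (Set.range fun a : A => ((a : W), f a)) := by
  have hfst : Prod.fst '' (Set.range fun a : A => ((a : W), f a)) = A := by
    rw [← Set.range_comp]
    exact Subtype.range_val
  have hsnd : Prod.snd '' (Set.range fun a : A => ((a : W), f a)) = Set.range f := by
    rw [← Set.range_comp]
    rfl
  have hran : FinGen E (Set.range f) := by
    rw [← Set.image_univ, finGen_image_iff f hf.closed, finGen_induce_univ_iff hA.closed]
    exact hfg
  refine ⟨⟨?_, ?_⟩, hfst.symm ▸ hA, hfst.symm ▸ hfg, hsnd.symm ▸ hf, hsnd.symm ▸ hran⟩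
  · rintro _ ⟨s, rfl⟩ _ ⟨t, rfl⟩
    exact Subtype.ext_iff.symm.trans f.injective.eq_iff.symm
  · rintro _ ⟨s, rfl⟩ _ ⟨t, rfl⟩
    exact f.map_rel_iff.symm

end Graphs

variable {X : Type*} {W W' : Type v} {Γ : Digraph X} {D : Digraph W} {E : Digraph W'}

theorem IsPartialIso.exists_extend_ran (hD : IsGeneric Γ D) (hE : IsGeneric Γ E)
    {R : Set (W × W')} (h : IsPartialIso D E R) (e : W') :
    ∃ R', IsPartialIso D E R' ∧ R ⊆ R' ∧ ∃ d, (d, e) ∈ R' := by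
  obtain ⟨Y, hY, -, hYR⟩ := h.finGen_ran
  obtain ⟨C, hC, hCfg, hYC, hCΓ⟩ := hE.exists_finGen (insert e Y) (hY.insert e)
  have hRC : Prod.snd '' R ⊆ C := hYR ▸ Set.iUnion₂_subset fun y hy =>
    hC.closed y (hYC (Set.mem_insert_of_mem e hy))
  obtain ⟨f, hfrange, hf⟩ := h.exists_emb
  have hfC (x) : f x ∈ C := hRC (hfrange ▸ Set.mem_range_self x)
  obtain ⟨g, hgf, hg⟩ := hD.extension _ h.strong_dom h.finGen_dom C (induce E C) hCΓ
    (codRestrict f C hfC) (strong_range_codRestrict f hC.closed hfC (hfrange ▸ h.strong_ran))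
  refine ⟨_, (isPartialIso_graph hC hCfg g hg).swap, fun p hp => ?_, g ⟨e, hYC (by simp)⟩,
    ⟨e, _⟩, rfl⟩
  have hp₂ : codRestrict f C hfC ⟨p.1, p, hp, rfl⟩ = ⟨p.2, hRC ⟨p, hp, rfl⟩⟩ :=
    Subtype.ext (hf p hp)
  exact ⟨⟨p.2, hRC ⟨p, hp, rfl⟩⟩, Prod.ext rfl (hp₂ ▸ hgf _)⟩

theorem IsPartialIso.exists_extend_dom (hD : IsGeneric Γ D) (hE : IsGeneric Γ E)
    {R : Set (W × W')} (h : IsPartialIso D E R) (d : W) :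
    ∃ R', IsPartialIso D E R' ∧ R ⊆ R' ∧ ∃ e, (d, e) ∈ R' := by
  obtain ⟨R', hR', hRR', hd⟩ := h.swap.exists_extend_ran hE hD d
  exact ⟨_, hR'.swap, Set.preimage_mono (f := Prod.swap) hRR', hd⟩

theorem IsPartialIso.exists_iso (hD : IsGeneric Γ D) (hE : IsGeneric Γ E)
    {R : Set (W × W')} (h : IsPartialIso D E R) : ∃ φ : Iso D E, ∀ p ∈ R, φ p.1 = p.2 := by
  have := hD.countable
  have := hE.countable
  let _ : Encodable W := Encodable.ofCountable W
  let _ : Encodable W' := Encodable.ofCountable W'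
  let R₀ : {R : Set (W × W') // IsPartialIso D E R} := ⟨R, h⟩
  let meets : W ⊕ W' → Order.Cofinal {R : Set (W × W') // IsPartialIso D E R} := Sum.elim
    (fun d => ⟨{S | ∃ e, (d, e) ∈ S.1}, fun S =>
      let ⟨S', hS', hSS', hd⟩ := S.2.exists_extend_dom hD hE d
      ⟨⟨S', hS'⟩, hd, hSS'⟩⟩)
    (fun e => ⟨{S | ∃ d, (d, e) ∈ S.1}, fun S =>
      let ⟨S', hS', hSS', he⟩ := S.2.exists_extend_ran hD hE e
      ⟨⟨S', hS'⟩, he, hSS'⟩⟩)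
  let J := Order.idealOfCofinals R₀ meets
  let family : Set (Set (W × W')) := Subtype.val '' (J : Set {R // IsPartialIso D E R})
  have hdirected : DirectedOn (fun S T : Set (W × W') => S ⊆ T) family :=
    directedOn_image.2 J.directed
  have hgraph : IsIsoGraph D E (⋃₀ family) :=
    IsIsoGraph.sUnion hdirected fun _ ⟨S, _, hS⟩ => hS ▸ S.2.toIsIsoGraph
  obtain ⟨φ, hφ⟩ := hgraph.exists_iso
    (fun d => by
      obtain ⟨S, ⟨e, he⟩, hS⟩ := Order.cofinal_meets_idealOfCofinals R₀ meets (Sum.inl d)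
      exact ⟨e, S.1, ⟨S, hS, rfl⟩, he⟩)
    (fun e => by
      obtain ⟨S, ⟨d, hd⟩, hS⟩ := Order.cofinal_meets_idealOfCofinals R₀ meets (Sum.inr e)
      exact ⟨d, S.1, ⟨S, hS, rfl⟩, hd⟩)
  exact ⟨φ, fun p hp => hφ p ⟨R, ⟨R₀, Order.mem_idealOfCofinals R₀ meets, rfl⟩, hp⟩⟩

theorem IsGeneric.exists_aut_extending (hD : IsGeneric Γ D) {A : Set W} (hA : Strong D A)
    (hfg : FinGen D A) (f : Emb (induce D A) D) (hf : Strong D (Set.range f)) :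
    ∃ g : Aut D, ∀ a : A, g a = f a := by
  obtain ⟨g, hg⟩ := (isPartialIso_graph hA hfg f hf).exists_iso hD hD
  exact ⟨g, fun a => hg _ ⟨a, rfl⟩⟩

theorem IsGeneric.exists_aut_inter_image_subset (hD : IsGeneric Γ D) {A : Set W}
    (hA : Strong D A) (hfg : FinGen D A) {C : Type*} {K : Digraph C}
    (i₁ i₂ : Emb K (induce D A)) (h₁ : Strong (induce D A) (Set.range i₁))
    (h₂ : Strong (induce D A) (Set.range i₂)) :
    ∃ g : Aut D, (∀ w, g (i₂ w) = i₁ w) ∧ A ∩ g '' A ⊆ Set.range fun w => (i₁ w : W) := by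
  have hC : InCBar Γ D := hD.inCBar
  have hAΓ : InC Γ (induce D A) := hC.inC_induce hA.closed hfg
  obtain ⟨U, B, f₁, f₂, hB⟩ := exists_isFreeAmalgam i₁ i₂
  obtain ⟨h, hf₁, hh⟩ := hD.extension A hA hfg U B (hB.inC h₁ h₂ hAΓ hAΓ) f₁
    (hB.strong_range_left h₁.closed h₂)
  have hf₂ : Strong D (Set.range (f₂.trans h)) := by
    have := (hB.symm.strong_range_left h₂.closed h₁).image h hh
    rwa [← Set.range_comp] at this
  obtain ⟨g, hg⟩ := hD.exists_aut_extending hA hfg (f₂.trans h) hf₂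
  refine ⟨g, fun w => ?_, ?_⟩
  · rw [hg, RelEmbedding.trans_apply, ← hB.comm, hf₁]
  · rintro z ⟨hz, y, hy, hyz⟩
    have heq : h (f₁ ⟨z, hz⟩) = h (f₂ ⟨y, hy⟩) :=
      (hf₁ _).trans (hyz.symm.trans (hg ⟨y, hy⟩))
    obtain ⟨w, hw, -⟩ := hB.exists_of_eq _ _ (h.injective heq)
    exact ⟨w, congrArg Subtype.val hw⟩

theorem IsGeneric.exists_aut_desc_inter_subset (hD : IsGeneric Γ D) (p q : W) (f : Emb Γ D)
    (hf : Set.range f = desc D p) (ψ : Aut Γ) :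
    ∃ g : Aut D, (∀ w, g (f (ψ w)) = f w) ∧ desc D q ∩ desc D (g q) ⊆ desc D p := by
  obtain ⟨A, hA, hfg, hpq, -⟩ := hD.exists_finGen {p, q} (Set.toFinite _)
  have hp : p ∈ A := hpq (by simp)
  have hq : q ∈ A := hpq (by simp)
  have hfA (w) : f w ∈ A := hA.closed p hp (hf ▸ Set.mem_range_self w)
  have hstrong : Strong D (Set.range f) := hf ▸ (hD.inCBar p).1
  have hi := strong_range_codRestrict f hA.closed hfA hstrong
  let i : Emb Γ (induce D A) := codRestrict f A hfA
  obtain ⟨g, hg, hsub⟩ := hD.exists_aut_inter_image_subset hA hfg i (ψ.toRelEmbedding.trans i) hi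
    (by rwa [show Set.range (ψ.toRelEmbedding.trans i) = Set.range i from
      ψ.surjective.range_comp i])
  refine ⟨g, hg, fun z ⟨hz, hz'⟩ => hf ▸ hsub ⟨hA.closed q hq hz, ?_⟩⟩
  obtain ⟨y, rfl⟩ := g.surjective z
  exact ⟨y, hA.closed q hq ((iso_mem_desc_iff g).1 hz'), rfl⟩

end Homogeneity

section Rooted

variable {V W : Type*} {Γ : Digraph V} {γ : V} {D : Digraph W}

theorem P0.exists_level (h0 : P0 Γ γ) (x : V) : ∃ n, x ∈ level Γ n γ :=
  mem_desc.1 (h0.rooted ▸ Set.mem_univ x)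

theorem P0.level_unique (h0 : P0 Γ γ) {x : V} {s t : ℕ} (hs : x ∈ level Γ s γ)
    (ht : x ∈ level Γ t γ) : s = t := by
  by_contra hst
  exact Set.disjoint_left.1 (h0.disjoint s t hst) hs ht

theorem P0.finite_outNeighbors (h0 : P0 Γ γ) (x : V) : {y | Γ.Adj x y}.Finite :=
  let ⟨_, _, h⟩ := h0.outValency
  Set.finite_of_encard_eq_coe (h x)

theorem P0.exists_adj (h0 : P0 Γ γ) (x : V) : ∃ y, Γ.Adj x y := by
  obtain ⟨m, hm, h⟩ := h0.outValency
  have hpos : 0 < {y | Γ.Adj x y}.encard := by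
    rw [h x]
    exact_mod_cast hm
  exact Set.encard_pos.1 hpos

theorem P0.eq_root (h0 : P0 Γ γ) {x : V} (hx : γ ∈ desc Γ x) : x = γ := by
  obtain ⟨s, hs⟩ := mem_desc.1 hx
  obtain ⟨t, ht⟩ := h0.exists_level x
  have hts : t + s = 0 := h0.level_unique (mem_level_add.2 ⟨x, ht, hs⟩) rfl
  obtain rfl : t = 0 := by omega
  exact ht

theorem P0.aut_root (h0 : P0 Γ γ) (ψ : Aut Γ) : ψ γ = γ := by
  obtain ⟨x, hx⟩ := ψ.surjective γ
  have h : ψ x ∈ desc Γ (ψ γ) := (iso_mem_desc_iff ψ).2 (h0.rooted ▸ Set.mem_univ x)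
  exact h0.eq_root (by rwa [hx] at h)

theorem P0.range_eq_desc (h0 : P0 Γ γ) (f : Emb Γ D) (hf : Closed D (Set.range f)) :
    Set.range f = desc D (f γ) := by
  rw [desc_map f hf, h0.rooted, Set.image_univ]

theorem P0.exists_emb (h0 : P0 Γ γ) {b : W} (e : Iso (induce D (desc D b)) Γ) :
    ∃ f : Emb Γ D, Closed D (Set.range f) ∧ f γ = b := by
  let f : Emb Γ D := e.symm.toRelEmbedding.trans (inclusion D (desc D b))
  have hrange : Set.range f = desc D b :=
    (e.symm.surjective.range_comp (inclusion D (desc D b))).trans (range_inclusion D _)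
  have hf : Closed D (Set.range f) := hrange ▸ closed_desc b
  obtain ⟨x, hx⟩ : b ∈ Set.range f := hrange ▸ self_mem_desc b
  have hγ : f γ ∈ desc D (f x) := by
    rw [hx, ← hrange]
    exact Set.mem_range_self γ
  rw [desc_map f hf, f.injective.mem_set_image] at hγ
  exact ⟨f, hf, h0.eq_root hγ ▸ hx⟩

theorem P0.mem_level_of_adj (h0 : P0 Γ γ) {v z : V} {n : ℕ} (hz : z ∈ level Γ (n + 1) γ)
    (h : Γ.Adj v z) : v ∈ level Γ n γ := by
  obtain ⟨t, ht⟩ := h0.exists_level v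
  obtain rfl : t = n := Nat.succ_injective (h0.level_unique ⟨v, ht, h⟩ hz)
  exact ht

theorem P0.finite_inNeighbors (h0 : P0 Γ γ) (z : V) : {v | Γ.Adj v z}.Finite := by
  obtain ⟨_ | n, hn⟩ := h0.exists_level z
  · have hempty : {v | Γ.Adj v z} = ∅ := by
      refine Set.eq_empty_of_forall_notMem fun v hv => ?_
      obtain ⟨t, ht⟩ := h0.exists_level v
      exact Nat.succ_ne_zero t (h0.level_unique ⟨v, ht, hv⟩ hn)
    exact hempty ▸ Set.finite_empty
  · exact (level_finite h0.finite_outNeighbors γ n).subset fun v => h0.mem_level_of_adj hn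

/-- The number of in-neighbours of a vertex, with the junk value `0` if there are infinitely
many. -/
noncomputable def inDegree (D : Digraph W) (z : W) : ℕ := {v | D.Adj v z}.ncard

theorem inDegree_eq_ncard_inter_range (f : Emb Γ D) (z : V) :
    inDegree Γ z = ({v | D.Adj v (f z)} ∩ Set.range f).ncard := by
  have hpreimage : {v | Γ.Adj v z} = f ⁻¹' {v | D.Adj v (f z)} :=
    Set.ext fun _ => f.map_rel_iff.symm
  rw [inDegree, hpreimage, ← Set.image_preimage_eq_inter_range,
    Set.ncard_image_of_injective _ f.injective]

theorem inDegree_iso (e : Iso Γ D) (z : V) : inDegree D (e z) = inDegree Γ z := by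
  have hrange : Set.range e.toRelEmbedding = Set.univ := e.surjective.range_eq
  rw [inDegree_eq_ncard_inter_range e.toRelEmbedding, hrange, Set.inter_univ]
  rfl

theorem inDegree_le_inDegree_map (f : Emb Γ D) {z : V} (hz : {v | D.Adj v (f z)}.Finite) :
    inDegree Γ z ≤ inDegree D (f z) := by
  rw [inDegree_eq_ncard_inter_range f]
  exact Set.ncard_le_ncard Set.inter_subset_left hz

theorem mem_range_of_inDegree_map_le (f : Emb Γ D) {z : V} (hz : {v | D.Adj v (f z)}.Finite)
    (hle : inDegree D (f z) ≤ inDegree Γ z) {v : W} (hv : D.Adj v (f z)) : v ∈ Set.range f := by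
  rw [inDegree_eq_ncard_inter_range f] at hle
  rw [← Set.mem_ofPred (p := fun v => D.Adj v (f z)),
    ← Set.eq_of_subset_of_ncard_le Set.inter_subset_left hle hz] at hv
  exact hv.2

theorem ncard_mul_le_ncard_mul_of_inDegree {S T : Set W} (hS : S.Finite) (hT : T.Finite)
    {m k : ℕ} (hST : ∀ z ∈ T, ∀ v, D.Adj v z → v ∈ S)
    (hout : ∀ v ∈ S, {z | D.Adj v z}.encard ≤ m) (hin : ∀ z ∈ T, k ≤ inDegree D z) :
    T.ncard * k ≤ S.ncard * m := by
  classical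
  rw [Set.ncard_eq_toFinset_card T hT, Set.ncard_eq_toFinset_card S hS]
  refine Finset.card_mul_le_card_mul (fun z v => D.Adj v z) (fun z hz => ?_) fun v hv => ?_
  · rw [Set.Finite.mem_toFinset] at hz
    refine (hin z hz).trans ?_
    rw [inDegree, ← Set.ncard_coe_finset]
    refine Set.ncard_le_ncard (fun v hv => ?_) (Finset.finite_toSet _)
    simpa [Finset.bipartiteAbove] using ⟨hST z hz v hv, hv⟩
  · rw [← ENat.natCast_le_natCast, ← Set.encard_coe_eq_coe_finsetCard]
    refine (Set.encard_le_encard fun z hz => ?_).trans (hout v (hS.mem_toFinset.1 hv))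
    exact (Finset.mem_filter.1 (Finset.mem_coe.1 hz)).2

theorem P0.exists_frequently_inDegree_le (h0 : P0 Γ γ) :
    ∃ m, ∃ᶠ n in atTop, ∃ z ∈ level Γ n γ, inDegree Γ z ≤ m := by
  obtain ⟨m, -, hout⟩ := h0.outValency
  refine ⟨m, fun hlarge => ?_⟩
  obtain ⟨s, hs⟩ := eventually_atTop.1 hlarge
  push Not at hs
  have hfin := level_finite h0.finite_outNeighbors γ
  have hanti : StrictAnti fun k => (level Γ (s + k) γ).ncard := by
    refine strictAnti_nat_of_succ_lt fun k => ?_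
    have hcount := ncard_mul_le_ncard_mul_of_inDegree (hfin (s + k)) (hfin (s + k + 1))
      (fun z hz v => h0.mem_level_of_adj hz) (fun v _ => (hout v).le)
      (hs (s + k + 1) (by omega))
    have hpos : 0 < (level Γ (s + k) γ).ncard :=
      (Set.ncard_pos (hfin (s + k))).2 (level_nonempty h0.exists_adj γ (s + k))
    by_contra! hle : (level Γ (s + k) γ).ncard ≤ (level Γ (s + k + 1) γ).ncard
    have hmul := Nat.mul_le_mul_right m hle
    rw [Nat.mul_succ] at hcount
    omega
  exact not_strictAnti_of_wellFoundedLT _ hanti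

theorem map_mem_level_add (f : Emb Γ D) (hf : Closed D (Set.range f)) {b : W} {s n : ℕ}
    {x y : V} (hx : f x ∈ level D s b) (hy : y ∈ level Γ n x) : f y ∈ level D (s + n) b :=
  mem_level_add.2 ⟨f x, hx, level_map f hf n x ▸ Set.mem_image_of_mem f hy⟩

theorem P0.exists_eventually_inDegree_eq (h0 : P0 Γ γ) (h1 : P1 Γ) (h3 : P3 Γ γ) :
    ∃ c, ∀ᶠ n in atTop, ∀ z ∈ level Γ n γ, inDegree Γ z = c := by
  choose r hr using level_nonempty h0.exists_adj γ
  have inDegree_eq (n : ℕ) (z : V) (hz : z ∈ level Γ n γ) :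
      inDegree Γ z = inDegree Γ (r n) := by
    obtain ⟨φ, rfl⟩ := h3 n (r n) (hr n) z hz
    exact inDegree_iso φ (r n)
  have hmono : Monotone fun n => inDegree Γ (r n) := by
    refine monotone_nat_of_le_succ fun n => ?_
    obtain ⟨f, hf, hfγ⟩ := h0.exists_emb (h1 (r 1)).some
    have hfr : f (r n) ∈ level Γ (n + 1) γ :=
      Nat.add_comm 1 n ▸ map_mem_level_add f hf (hfγ ▸ hr 1) (hr n)
    rw [← inDegree_eq (n + 1) _ hfr]
    exact inDegree_le_inDegree_map f (h0.finite_inNeighbors _)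
  obtain htop | ⟨c, hc⟩ := tendsto_atTop_of_monotone hmono
  · obtain ⟨m, hm⟩ := h0.exists_frequently_inDegree_le
    obtain ⟨n, ⟨z, hz, hzm⟩, hn⟩ := (hm.and_eventually (htop.eventually_gt_atTop m)).exists
    exact absurd hzm (inDegree_eq n z hz ▸ hn.not_ge)
  · rw [nhds_discrete, tendsto_pure] at hc
    exact ⟨c, hc.mono fun n hn z hz => (inDegree_eq n z hz).trans hn⟩

theorem P0.eventually_mem_desc_of_adj (h0 : P0 Γ γ) (h1 : P1 Γ) (h3 : P3 Γ γ) (x : V) :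
    ∀ᶠ n in atTop, ∀ v ∈ level Γ n γ, ∀ z, Γ.Adj v z → z ∈ desc Γ x → v ∈ desc Γ x := by
  obtain ⟨c, hc⟩ := h0.exists_eventually_inDegree_eq h1 h3
  obtain ⟨N, hN⟩ := eventually_atTop.1 hc
  obtain ⟨f, hf, rfl⟩ := h0.exists_emb (h1 x).some
  obtain ⟨s, hs⟩ := h0.exists_level (f γ)
  filter_upwards [eventually_ge_atTop (N + s)] with n hn v hv z hvz hz
  rw [← h0.range_eq_desc f hf] at hz ⊢
  obtain ⟨w, rfl⟩ := hz
  obtain ⟨t, ht⟩ := h0.exists_level w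
  have hlevel : s + t = n + 1 := h0.level_unique (map_mem_level_add f hf hs ht) ⟨v, hv, hvz⟩
  refine mem_range_of_inDegree_map_le f (h0.finite_inNeighbors _) ?_ hvz
  rw [hN (n + 1) (by omega) (f w) ⟨v, hv, hvz⟩, hN t (by omega) w ht]

end Rooted

section Generic

variable {V : Type*} {W : Type v} {Γ : Digraph V} {γ : V} {D : Digraph W}

theorem InCBar.exists_emb (hC : InCBar Γ D) (h0 : P0 Γ γ) (b : W) :
    ∃ f : Emb Γ D, Closed D (Set.range f) ∧ f γ = b :=
  h0.exists_emb (hC b).2.some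

theorem InCBar.exists_adj (hC : InCBar Γ D) (h0 : P0 Γ γ) (b : W) : ∃ y, D.Adj b y := by
  obtain ⟨f, -, rfl⟩ := hC.exists_emb h0 b
  obtain ⟨y, hy⟩ := h0.exists_adj γ
  exact ⟨f y, f.map_rel_iff.2 hy⟩

theorem InCBar.level_finite (hC : InCBar Γ D) (h0 : P0 Γ γ) (b : W) (n : ℕ) :
    (level D n b).Finite := by
  obtain ⟨f, hf, rfl⟩ := hC.exists_emb h0 b
  rw [level_map f hf]
  exact (DescDigraph.level_finite h0.finite_outNeighbors γ n).image f

theorem InCBar.eventually_mem_desc_of_adj (hC : InCBar Γ D) (h0 : P0 Γ γ) (h1 : P1 Γ)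
    (h3 : P3 Γ γ) {b x : W} (hx : x ∈ desc D b) :
    ∀ᶠ n in atTop, ∀ v ∈ level D n b, ∀ z, D.Adj v z → z ∈ desc D x → v ∈ desc D x := by
  obtain ⟨f, hf, rfl⟩ := hC.exists_emb h0 b
  rw [← h0.range_eq_desc f hf] at hx
  obtain ⟨x, rfl⟩ := hx
  filter_upwards [h0.eventually_mem_desc_of_adj h1 h3 x] with n hn
  rw [level_map f hf, desc_map f hf]
  rintro _ ⟨v, hv, rfl⟩ _ hvz ⟨z, hz, rfl⟩
  exact Set.mem_image_of_mem f (hn v hv z (f.map_rel_iff.1 hvz) hz)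

theorem InCBar.eventually_mem_of_adj (hC : InCBar Γ D) (h0 : P0 Γ γ) (h1 : P1 Γ)
    (h3 : P3 Γ γ) {A : Set W} (hA : Strong D A) (b : W) :
    ∀ᶠ n in atTop, ∀ v ∈ level D n b, ∀ z, D.Adj v z → z ∈ A → v ∈ A := by
  obtain ⟨X, hX, hXsub, hXeq⟩ := hA.finGen_inter b
  have hall := (Set.Finite.eventually_all hX).2 fun x hx =>
    hC.eventually_mem_desc_of_adj h0 h1 h3 (hXsub hx).1
  filter_upwards [hall] with n hn v hv z hvz hz
  have hvb : v ∈ desc D b := level_subset_desc n b hv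
  have hzX : z ∈ desc D b ∩ A := ⟨(closed_desc b).mem_of_adj hvb hvz, hz⟩
  rw [hXeq] at hzX
  obtain ⟨x, hx, hzx⟩ := Set.mem_iUnion₂.1 hzX
  exact hA.closed x (hXsub hx).2 (hn x hx v hv z hvz hzx)

theorem InCBar.exists_mem_level_notMem (hC : InCBar Γ D) (h0 : P0 Γ γ) {A : Set W}
    (hA : Strong D A) {p : W} (hp : p ∉ A) (N : ℕ) : ∃ y ∈ level D N p, y ∉ A := by
  by_contra! hlevel
  have hsub : desc D p \ A ⊆ ⋃ n ∈ Set.Iio N, level D n p := by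
    rintro z ⟨hz, hzA⟩
    obtain ⟨n, hn⟩ := mem_desc.1 hz
    refine Set.mem_biUnion (Set.mem_Iio.2 (not_le.1 fun hNn => hzA ?_)) hn
    obtain ⟨k, rfl⟩ := Nat.exists_eq_add_of_le hNn
    obtain ⟨y, hy, hzy⟩ := mem_level_add.1 hn
    exact hA.closed y (hlevel y hy) (level_subset_desc k y hzy)
  exact hp (hA.mem_of_finite p
    (((Set.finite_Iio N).biUnion fun n _ => hC.level_finite h0 p n).subset hsub))

theorem notMem_desc_of_inter_subset {p q : W} (g : Aut D) (hgp : g p = p)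
    (hsub : desc D q ∩ desc D (g q) ⊆ desc D p) (hq : q ∉ desc D p) :
    q ∉ desc D (g q) ∧ g q ∉ desc D q := by
  refine ⟨fun h => hq (hsub ⟨self_mem_desc q, h⟩), fun h => hq ?_⟩
  rw [← iso_mem_desc_iff g, hgp]
  exact hsub ⟨h, self_mem_desc (g q)⟩

theorem IsGeneric.exists_aut_of_mem_level (hD : IsGeneric Γ D) (h0 : P0 Γ γ) (h3 : P3 Γ γ)
    {n : ℕ} {p x y : W} (hx : x ∈ level D n p) (hy : y ∈ level D n p) (q : W) :
    ∃ g : Aut D, g p = p ∧ g y = x ∧ desc D q ∩ desc D (g q) ⊆ desc D p := by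
  have hC : InCBar Γ D := hD.inCBar
  obtain ⟨f, hf, rfl⟩ := hC.exists_emb h0 p
  rw [level_map f hf] at hx hy
  obtain ⟨x, hx, rfl⟩ := hx
  obtain ⟨y, hy, rfl⟩ := hy
  obtain ⟨ψ, rfl⟩ := h3 n x hx y hy
  obtain ⟨g, hg, hsub⟩ := hD.exists_aut_desc_inter_subset (f γ) q f (h0.range_eq_desc f hf) ψ
  exact ⟨g, by simpa only [h0.aut_root] using hg γ, hg x, hsub⟩

/-- The common descendants of `p` and `q` lie at the same distance from `q` as from `p`, and from
level `N` of `desc p` on they are closed under in-neighbours in `desc p`. These properties are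
inherited by the successive pairs of a separating chain. -/
structure Coherent (D : Digraph W) (N : ℕ) (p q : W) : Prop where
  level_inter_subset : ∀ n, level D n p ∩ desc D q ⊆ level D n q
  mem_of_adj : ∀ n, N ≤ n → ∀ v ∈ level D n p, ∀ z, D.Adj v z → z ∈ desc D q → v ∈ desc D q

theorem Coherent.map {N : ℕ} {p q : W} (h : Coherent D N p q) (g : Aut D) :
    Coherent D N (g p) (g q) where
  level_inter_subset n z hz := by
    obtain ⟨z, rfl⟩ := g.surjective z
    rw [Set.mem_inter_iff, iso_mem_level_iff, iso_mem_desc_iff] at hz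
    exact (iso_mem_level_iff g).2 (h.level_inter_subset n hz)
  mem_of_adj n hn v hv z hvz hz := by
    obtain ⟨v, rfl⟩ := g.surjective v
    obtain ⟨z, rfl⟩ := g.surjective z
    rw [iso_mem_level_iff] at hv
    rw [iso_mem_desc_iff] at hz ⊢
    exact h.mem_of_adj n hn v hv z (g.map_rel_iff.1 hvz) hz

theorem Coherent.trans {N : ℕ} {p q q' : W} (hqp : Coherent D N q p) (hpq' : Coherent D N p q')
    (hsub : desc D q ∩ desc D q' ⊆ desc D p) : Coherent D N q q' where
  level_inter_subset n z hz := hpq'.level_inter_subset n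
    ⟨hqp.level_inter_subset n ⟨hz.1, hsub ⟨level_subset_desc n q hz.1, hz.2⟩⟩, hz.2⟩
  mem_of_adj n hn v hv z hvz hz := by
    have hzq : z ∈ desc D q := (closed_desc q).mem_of_adj (level_subset_desc n q hv) hvz
    have hvp : v ∈ desc D p := hqp.mem_of_adj n hn v hv z hvz (hsub ⟨hzq, hz⟩)
    exact hpq'.mem_of_adj n hn v (hqp.level_inter_subset n ⟨hv, hvp⟩) z hvz hz

theorem Coherent.disjoint_desc {N : ℕ} {p q : W} (h : Coherent D N p q)
    (hadj : ∀ x, ∃ y, D.Adj x y) (hN : Disjoint (level D N p) (desc D q)) :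
    Disjoint (desc D p) (desc D q) := by
  have hdeep (k : ℕ) : Disjoint (level D (N + k) p) (desc D q) := by
    induction k with
    | zero => exact hN
    | succ k ih =>
      refine Set.disjoint_left.2 fun z ⟨v, hv, hvz⟩ hz => ?_
      exact Set.disjoint_left.1 ih hv (h.mem_of_adj _ (Nat.le_add_right N k) v hv z hvz hz)
  refine Set.disjoint_left.2 fun z hz hzq => ?_
  obtain ⟨k, hk⟩ := mem_desc.1 hz
  obtain ⟨y, hy⟩ := level_nonempty hadj z N
  refine Set.disjoint_left.1 (hdeep k) ?_ (closed_desc q z hzq (level_subset_desc N z hy))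
  rw [Nat.add_comm]
  exact mem_level_add.2 ⟨z, hk, hy⟩

theorem IsGeneric.exists_coherent (hD : IsGeneric Γ D) (h0 : P0 Γ γ) (h1 : P1 Γ)
    (h3 : P3 Γ γ) (p q : W) :
    ∃ (g : Aut D) (N : ℕ), g p = p ∧ desc D q ∩ desc D (g q) ⊆ desc D p ∧
      Coherent D N q (g q) ∧ Coherent D N (g q) q := by
  have hC : InCBar Γ D := hD.inCBar
  obtain ⟨f, hf, rfl⟩ := hC.exists_emb h0 p
  obtain ⟨g, hg, hsub⟩ := hD.exists_aut_desc_inter_subset (f γ) q f (h0.range_eq_desc f hf)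
    (RelIso.refl _)
  have mem_level_iff (n : ℕ) (z : W) (hz : z ∈ desc D q ∩ desc D (g q)) :
      z ∈ level D n (g q) ↔ z ∈ level D n q := by
    obtain ⟨w, rfl⟩ := h0.range_eq_desc f hf ▸ hsub hz
    have hw : g (f w) = f w := hg w
    rw [← iso_mem_level_iff g (x := q), hw]
  have hq := hC.eventually_mem_of_adj h0 h1 h3 (hD.inCBar (g q)).1 q
  have hgq := hC.eventually_mem_of_adj h0 h1 h3 (hD.inCBar q).1 (g q)
  obtain ⟨N, hN⟩ := eventually_atTop.1 (hq.and hgq)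
  refine ⟨g, N, hg γ, hsub, ⟨fun n z hz => ?_, fun n hn => (hN n hn).1⟩,
    ⟨fun n z hz => ?_, fun n hn => (hN n hn).2⟩⟩
  · exact (mem_level_iff n z ⟨level_subset_desc n q hz.1, hz.2⟩).2 hz.1
  · exact (mem_level_iff n z ⟨hz.2, level_subset_desc n (g q) hz.1⟩).1 hz.1

theorem IsGeneric.exists_aut_ncard_lt (hD : IsGeneric Γ D) (h0 : P0 Γ γ) (h3 : P3 Γ γ) {N : ℕ}
    {p q : W} (h : Coherent D N q p) (hp : p ∉ desc D q)
    (hne : (level D N p ∩ desc D q).Nonempty) :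
    ∃ g : Aut D, g p = p ∧ desc D q ∩ desc D (g q) ⊆ desc D p ∧
      (level D N q ∩ desc D (g q)).ncard < (level D N p ∩ desc D q).ncard := by
  have hC : InCBar Γ D := hD.inCBar
  obtain ⟨x, hx, hxq⟩ := hne
  obtain ⟨y, hy, hyq⟩ := hC.exists_mem_level_notMem h0 (hD.inCBar q).1 hp N
  obtain ⟨g, hgp, rfl, hsub⟩ := hD.exists_aut_of_mem_level h0 h3 hx hy q
  refine ⟨g, hgp, hsub, Set.ncard_lt_ncard (ssubset_of_subset_not_subset ?_ fun hsup => ?_)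
    ((hC.level_finite h0 p N).inter_of_left _)⟩
  · rintro z ⟨hz, hzg⟩
    have hzq : z ∈ desc D q := level_subset_desc N q hz
    exact ⟨h.level_inter_subset N ⟨hz, hsub ⟨hzq, hzg⟩⟩, hzq⟩
  · exact hyq ((iso_mem_desc_iff g).1 (hsup ⟨hx, hxq⟩).2)

/-- There is a sequence `c 0 = p`, `c 1 = q`, …, `c (r + 1)` whose last two members have disjoint
descendant sets, such that each `c (i + 1)` is the image of `c i` under an automorphism `g i` fixing
`c (i - 1)`. -/
def SeparatingChain (D : Digraph W) (r : ℕ) (p q : W) : Prop :=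
  ∃ (g : ℕ → Aut D) (c : ℕ → W), c 0 = p ∧ c 1 = q ∧
    (∀ i : ℕ, 1 ≤ i → i ≤ r → c (i + 1) = g i (c i) ∧ g i (c (i - 1)) = c (i - 1)) ∧
    Disjoint (desc D (c r)) (desc D (c (r + 1)))

theorem separatingChain_zero {p q : W} (h : Disjoint (desc D p) (desc D q)) :
    SeparatingChain D 0 p q :=
  ⟨fun _ => RelIso.refl _, fun i => Nat.casesOn i p fun _ => q, rfl, rfl,
    fun i hi hi' => by omega, h⟩

theorem SeparatingChain.cons {r : ℕ} {p q : W} (g : Aut D) (hgp : g p = p)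
    (h : SeparatingChain D r q (g q)) : SeparatingChain D (r + 1) p q := by
  obtain ⟨g', c, hc₀, hc₁, hc, hdisjoint⟩ := h
  refine ⟨fun i => if i ≤ 1 then g else g' (i - 1), fun i => Nat.casesOn i p c, rfl, hc₀, ?_,
    hdisjoint⟩
  rintro (_ | _ | i) hi hir
  · omega
  · exact ⟨by simp [hc₀, hc₁], by simp [hgp]⟩
  · simpa using hc (i + 1) (by omega) (by omega)

theorem IsGeneric.exists_separatingChain (hD : IsGeneric Γ D) (h0 : P0 Γ γ) (h3 : P3 Γ γ)
    {N : ℕ} {p q : W} (hpq : Coherent D N p q) (hqp : Coherent D N q p) (hp : p ∉ desc D q)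
    (hq : q ∉ desc D p) : ∃ r, SeparatingChain D r p q := by
  induction hk : (level D N p ∩ desc D q).ncard using Nat.strong_induction_on
    generalizing p q with
  | _ k ih =>
    rcases Set.eq_empty_or_nonempty (level D N p ∩ desc D q) with hempty | hne
    · have hC : InCBar Γ D := hD.inCBar
      have hdisjoint := hpq.disjoint_desc (hC.exists_adj h0)
        (Set.disjoint_iff_inter_eq_empty.2 hempty)
      exact ⟨0, separatingChain_zero hdisjoint⟩
    · obtain ⟨g, hgp, hsub, hlt⟩ := hD.exists_aut_ncard_lt h0 h3 hqp hp hne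
      have hpgq : Coherent D N p (g q) := hgp ▸ hpq.map g
      have hgqp : Coherent D N (g q) p := by simpa only [hgp] using hqp.map g
      obtain ⟨hq_notMem, hgq_notMem⟩ := notMem_desc_of_inter_subset g hgp hsub hq
      obtain ⟨r, hr⟩ := ih _ (hk ▸ hlt) (hqp.trans hpgq hsub)
        (hgqp.trans hpq (Set.inter_comm _ _ ▸ hsub)) hq_notMem hgq_notMem rfl
      exact ⟨r + 1, hr.cons g hgp⟩

end Generic

end DescDigraph

theorem mainTheorem7_general {V : Type u} {W : Type v} (Γ : Digraph V) (γ : V)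
    (h0 : DescDigraph.P0 Γ γ) (h1 : DescDigraph.P1 Γ) (h3 : DescDigraph.P3 Γ γ)
    (D : Digraph W) (hD : DescDigraph.IsGeneric Γ D) (a b : W) (hb : b ∉ DescDigraph.desc D a) :
    ∃ r : ℕ, 1 ≤ r ∧ ∃ (g : ℕ → DescDigraph.Aut D) (c : ℕ → W),
      c 0 = a ∧ c 1 = b ∧
      (∀ i : ℕ, 1 ≤ i → i ≤ r → c (i + 1) = g i (c i) ∧ g i (c (i - 1)) = c (i - 1)) ∧
      Disjoint (DescDigraph.desc D (c r)) (DescDigraph.desc D (c (r + 1))) := by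
  obtain ⟨g, N, hga, hsub, hcoherent, hcoherent'⟩ := hD.exists_coherent h0 h1 h3 a b
  obtain ⟨hb_notMem, hgb_notMem⟩ := DescDigraph.notMem_desc_of_inter_subset g hga hsub hb
  obtain ⟨r, hr⟩ := hD.exists_separatingChain h0 h3 hcoherent hcoherent' hb_notMem hgb_notMem
  exact ⟨r + 1, Nat.le_add_left 1 r, hr.cons g hga⟩

theorem mainTheorem7 {V : Type u} {W : Type v} (Γ : Digraph V) (γ : V)
    (h0 : DescDigraph.P0 Γ γ) (h1 : DescDigraph.P1 Γ) (h2 : DescDigraph.P2 Γ)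
    (h3 : DescDigraph.P3 Γ γ)
    (D : Digraph W) (hD : DescDigraph.IsGeneric Γ D)
    (a b : W) (hne : a ≠ b) (ha : a ∉ DescDigraph.desc D b) (hb : b ∉ DescDigraph.desc D a) :
    ∃ r : ℕ, 1 ≤ r ∧ ∃ (g : ℕ → DescDigraph.Aut D) (c : ℕ → W),
      c 0 = a ∧ c 1 = b ∧
      (∀ i : ℕ, 1 ≤ i → i ≤ r → c (i + 1) = g i (c i) ∧ g i (c (i - 1)) = c (i - 1)) ∧
      Disjoint (DescDigraph.desc D (c r)) (DescDigraph.desc D (c (r + 1))) :=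
  mainTheorem7_general Γ γ h0 h1 h3 D hD a b hb
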